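/- **Setting.** Let $n\ge 2$ and $N=[n]$. A stochastic cooperative game assigns to each coalition $S\subseteq N$ a probability distribution $\mathbb P_S$ on $[0,1]$; let $\mu(S)$ be its mean, and assume $\mu(\varnothing)=0$. Its expected core is $$\text{E-Core}=\Big\{x\in\mathbb R^n : \sum_{i\in N}x_i=\mu(N),\ \sum_{i\in S}x_i\ge\mu(S)\ \ \forall S\subseteq N\Big\}.$$ For $\varsigma>0$ the game is $\varsigma$-strictly convex if $\mu$ is supermodular and $\mu(S\cup\{i\})-\mu(S)\ge\mu(C\cup\{i\})-\mu(C)+\varsigma$ for all $C\subsetneq S\subseteq N$ and $i\notin S$. **Orders.** For a permutation $\omega$ of $[n]$ ($\omega(j)$ is the position of agent $j$) let $P^\omega_i=\{j:\omega(j)\le\omega(i)\}$. Let $\mathcal P=\{\omega_1,\dots,\omega_n\}=\{\omega,\omega s_1,\dots,\omega s_{n-1}\}$, where $\omega s_i$ is the order obtained from $\omega$ by exchanging the two agents in positions $i$ and $i+1$. **The algorithm** Common-Points-Picking, with inputs $\mathcal P$, $\delta$ and the known value $\mu(N)$, works in epochs $s=1,2,\dots$. In epoch $s$ it queries, for every $p,i\in[n]$,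 the coalition $P^{\omega_p}_i$ and receives an independent sample $r^p_s(P^{\omega_p}_i)\sim\mathbb P_{P^{\omega_p}_i}$, so an epoch uses $n^2$ samples; it always puts $r^p_s(\varnothing)=0$ and $r^p_s(N)=\mu(N)$. After epoch $k$ it computes $$x^p_i=\frac1k\sum_{s=1}^k\Big(r^p_s(P^{\omega_p}_i)-r^p_s(P^{\omega_p}_i\setminus\{i\})\Big),\qquad b=\sqrt{\frac{2\log(nk\delta^{-1})}{k}},\qquad \epsilon=2\sqrt n\,b .$$ It stops after the first epoch in which for every $p\in[n]$ there are $v\in\mathbb R^n$, $c\in\mathbb R$ with $\|v\|_2=1$, $\langle v,\mathbf 1_n\rangle=0$, $\langle v,x^q\rangle=c+\epsilon$ for all $q\ne p$, $\langle v,x^p\rangle<c+\epsilon$, and $$\inf_{x\in\mathbb R^n:\ \|x-x^p\|_\infty<b}\big(c-\langle v,x\rangle\big)\ \ge\ n\epsilon ;$$ it then returns $x^\star=\frac1n\sum_{p=1}^n x^p$. **Theorem 4.** There is an absolute constant $A>0$ such that for every $n\ge2$, every $\varsigma>0$, every $\varsigma$-strictly convex game as above, every permutation $\omega$ of $[n]$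 and every $\delta\in(0,1]$, with probability at least $1-\delta$ the algorithm stops after $$T\ \le\ A\,\frac{n^{15}\log(n\,\delta^{-1}\varsigma^{-1})}{\varsigma^4}$$ samples and returns a point of $\text{E-Core}$. -/

import Mathlib

open MeasureTheory ProbabilityTheory

noncomputable section

/-- A stochastic cooperative game on the agents `Fin n`: a reward distribution on `[0,1]` for
every coalition. -/
structure StochasticGame (n : ℕ) where
  reward : Finset (Fin n) → ProbabilityMeasure unitInterval

/-- The expected reward `μ(S)` of the coalition `S`. -/
def StochasticGame.expectedReward {n : ℕ} (G : StochasticGame n) (S : Finset (Fin n)) : ℝ :=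
  ∫ x, (x : ℝ) ∂(G.reward S : Measure unitInterval)

/-- Supermodularity of a set function. -/
def IsSupermodular {n : ℕ} (f : Finset (Fin n) → ℝ) : Prop :=
  ∀ (C S : Finset (Fin n)) (i : Fin n), C ⊆ S → i ∉ S →
    f (insert i C) - f C ≤ f (insert i S) - f S

/-- Strict supermodularity with constant `ς`: the marginal contribution of `i` grows by at least
`ς` from `C` to any strictly larger coalition `S` (for `C = S` no gap is possible). -/
def IsStrictlySupermodular {n : ℕ} (ς : ℝ) (f : Finset (Fin n) → ℝ) : Prop :=
  IsSupermodular f ∧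
    ∀ (C S : Finset (Fin n)) (i : Fin n), C ⊂ S → i ∉ S →
      f (insert i C) - f C + ς ≤ f (insert i S) - f S

/-- The game is `ς`-strictly convex. -/
def StochasticGame.IsStrictlyConvex {n : ℕ} (G : StochasticGame n) (ς : ℝ) : Prop :=
  IsStrictlySupermodular ς G.expectedReward

/-- The expected core. -/
def StochasticGame.expectedCore {n : ℕ} (G : StochasticGame n) : Set (Fin n → ℝ) :=
  {x | ∑ i, x i = G.expectedReward Finset.univ ∧
    ∀ S : Finset (Fin n), G.expectedReward S ≤ ∑ i ∈ S, x i}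

namespace CommonPointsPicking

/-- The coalition `P^ω_i = {j | ω(j) ≤ ω(i)}`; `ω(j)` is the position of agent `j`. -/
def prefixCoalition {n : ℕ} (ω : Equiv.Perm (Fin n)) (i : Fin n) : Finset (Fin n) :=
  Finset.univ.filter fun j => ω j ≤ ω i

/-- The collection `ω, ω s₁, …, ω s_{n-1}`. The product `ω s_k` is read from left to right: it
exchanges the two agents whose positions in the order `ω` are consecutive. The member with
index `0` is `ω`, the one with index `p ≥ 1` exchanges the (0-based) positions `p - 1` and `p`. -/
def adjacentFamily {n : ℕ} (ω : Equiv.Perm (Fin n)) (p : Fin n) : Equiv.Perm (Fin n) :=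
  if p.val = 0 then ω
  else ω.trans (Equiv.swap ⟨p.val - 1, lt_of_le_of_lt (Nat.sub_le _ _) p.isLt⟩ p)

/-- The reward that one pass along the order `ω` attributes to the coalition `S`, where `a i` is
the oracle's answer to the query of `P^ω_i`: it is `0` for the empty coalition, the known value
`μN` for the grand coalition, and `a i` if `S = P^ω_i` (for exactly one `i`) otherwise. -/
def passReward {n : ℕ} (μN : ℝ) (ω : Equiv.Perm (Fin n)) (a : Fin n → unitInterval)
    (S : Finset (Fin n)) : ℝ :=
  if S = ∅ then 0
  else if S = Finset.univ then μN
  else ∑ i with prefixCoalition ω i = S, (a i : ℝ)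

/-- The empirical marginal vector of the order `ω` after `ep` epochs; `a s i` is the answer to the
query of `P^ω_i` in epoch `s + 1`. -/
def empiricalMarginal {n : ℕ} (μN : ℝ) (ω : Equiv.Perm (Fin n))
    (a : ℕ → Fin n → unitInterval) (ep : ℕ) : Fin n → ℝ := fun i =>
  (1 / (ep : ℝ)) * ∑ s ∈ Finset.range ep,
    (passReward μN ω (a s) (prefixCoalition ω i)
      - passReward μN ω (a s) ((prefixCoalition ω i).erase i))

/-- The confidence bonus `b_ep`. -/
def confidenceBonus (n : ℕ) (δ : ℝ) (ep : ℕ) : ℝ :=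
  Real.sqrt (2 * Real.log (n * ep * δ⁻¹) / ep)

/-- `(v, c)` solves the system that defines the hyperplane `H_p(Q)` with offset `ε`. -/
def IsSeparatingPair {n : ℕ} (Q : Fin n → Fin n → ℝ) (ε : ℝ) (p : Fin n)
    (v : Fin n → ℝ) (c : ℝ) : Prop :=
  ‖WithLp.toLp 2 v‖ = 1 ∧
  (∀ q, q ≠ p → v ⬝ᵥ Q q = c + ε) ∧
  v ⬝ᵥ Q p < c + ε ∧
  v ⬝ᵥ (fun _ => (1 : ℝ)) = 0

/-- The distance `h_p` (the norm on `Fin n → ℝ` is the sup norm). -/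
def hyperplaneDistance {n : ℕ} (Q : Fin n → Fin n → ℝ) (b : ℝ) (p : Fin n)
    (v : Fin n → ℝ) (c : ℝ) : ℝ :=
  sInf ((fun x : Fin n → ℝ => c - v ⬝ᵥ x) '' {x | ‖x - Q p‖ < b})

/-- The stopping condition returns TRUE: with `ε = 2 √n b`, every hyperplane `H_p(Q)` can be
computed and satisfies `h_p ≥ n ε`. (If one of the systems has no solution, it returns FALSE; if
all of them have solutions, the points are affinely independent and the solutions unique.) -/
def StoppingCondition {n : ℕ} (Q : Fin n → Fin n → ℝ) (b : ℝ) : Prop :=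
  ∀ p : Fin n, ∃ (v : Fin n → ℝ) (c : ℝ),
    IsSeparatingPair Q (2 * Real.sqrt n * b) p v c ∧
    (n : ℝ) * (2 * Real.sqrt n * b) ≤ hyperplaneDistance Q b p v c

/-- The collection `Q` of empirical marginal vectors of the orders `P p` after `ep` epochs;
`r s p i` is the answer to the query `(p, i)`, i.e. of `P^{ω_p}_i`, in epoch `s + 1`. -/
def estimates {n : ℕ} (μN : ℝ) (P : Fin n → Equiv.Perm (Fin n))
    (r : ℕ → Fin n → Fin n → unitInterval) (ep : ℕ) : Fin n → Fin n → ℝ := fun p =>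
  empiricalMarginal μN (P p) (fun s => r s p) ep

/-- Run with the orders `P`, the known value `μN = μ(N)` and the parameter `δ`, on the oracle
answers `r`, the algorithm stops after `T` queries and returns `x`: it ends with the first epoch
`ep ≥ 1` after which the stopping condition holds, each epoch makes `n * n` queries, and the
output is the average of the current estimates. -/
def Returns {n : ℕ} (μN δ : ℝ) (P : Fin n → Equiv.Perm (Fin n))
    (r : ℕ → Fin n → Fin n → unitInterval) (T : ℕ) (x : Fin n → ℝ) : Prop :=
  ∃ ep : ℕ, 1 ≤ ep ∧
    StoppingCondition (estimates μN P r ep) (confidenceBonus n δ ep) ∧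
    (∀ k, 1 ≤ k → k < ep →
      ¬ StoppingCondition (estimates μN P r k) (confidenceBonus n δ k)) ∧
    T = ep * (n * n) ∧
    x = fun i => (1 / (n : ℝ)) * ∑ p, estimates μN P r ep p i

end CommonPointsPicking

end

/-! The true marginal vectors φ_p of the adjacent orders lie in the core, and strict convexity
spreads them out: φ_p - φ_0 = g (e_a - e_b) for the two exchanged agents, with g ≥ ς. Suppose that
every estimate Q_p is within b of φ_p in the sup norm.

The test passes once b < ς / (6n³) (`stoppingCondition_of_abs_sub_le`). If some Q_p were close to
the hyperplane through the others, its unit normal v would be nearly constant on every exchanged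
pair, hence nearly constant; having zero sum, it would be too short (`le_abs_gap`).

A passed test is sound (`StoppingCondition.le_dotProduct_average`). It makes the barycentric
coordinates of φ_q with respect to the Q_p so close to those of Q_q that any linear inequality valid
at all φ_q also holds at the average of the Q_p. The core inequalities are of this kind.

Precision comes from Hoeffding's inequality and a union bound over the epochs from 3 to K
(`measure_bonus_le_le`), where b is small enough at K (`exists_epoch`). Earlier epochs need no
control, since the test fails there for every sample (`StoppingCondition.three_le`). -/

theorem StochasticGame.expectedReward_mem_Icc {n : ℕ} (G : StochasticGame n)
    (S : Finset (Fin n)) : G.expectedReward S ∈ Set.Icc (0 : ℝ) 1 := by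
  unfold StochasticGame.expectedReward
  have hI : Integrable (fun x : unitInterval => (x : ℝ)) (G.reward S : Measure unitInterval) :=
    Integrable.of_mem_Icc 0 1 measurable_subtype_coe.aemeasurable
      (Filter.Eventually.of_forall fun x => x.2)
  constructor
  · exact integral_nonneg fun x => x.2.1
  · calc _ ≤ ∫ _x, (1 : ℝ) ∂(G.reward S : Measure unitInterval) :=
        integral_mono hI (integrable_const _) fun x => x.2.2
      _ = 1 := by simp

namespace CommonPointsPicking

/-! ### Marginal vectors, the core and adjacent orders -/

/-- The coalition of the first `m` agents in the order `ω`. -/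
def initialCoalition {n : ℕ} (ω : Equiv.Perm (Fin n)) (m : ℕ) : Finset (Fin n) :=
  Finset.univ.filter fun j => (ω j : ℕ) < m

/-- The marginal vector of the set function `f` for the order `ω`. -/
def marginalVector {n : ℕ} (f : Finset (Fin n) → ℝ) (ω : Equiv.Perm (Fin n)) : Fin n → ℝ :=
  fun i => f (prefixCoalition ω i) - f ((prefixCoalition ω i).erase i)

variable {n : ℕ}

theorem mem_prefixCoalition {ω : Equiv.Perm (Fin n)} {i j : Fin n} :
    j ∈ prefixCoalition ω i ↔ ω j ≤ ω i := by
  simp [prefixCoalition]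

theorem self_mem_prefixCoalition (ω : Equiv.Perm (Fin n)) (i : Fin n) :
    i ∈ prefixCoalition ω i := mem_prefixCoalition.2 le_rfl

theorem prefixCoalition_injective (ω : Equiv.Perm (Fin n)) :
    Function.Injective (prefixCoalition ω) := by
  intro i j h
  have h₁ : i ∈ prefixCoalition ω j := h ▸ self_mem_prefixCoalition ω i
  have h₂ : j ∈ prefixCoalition ω i := h ▸ self_mem_prefixCoalition ω j
  exact ω.injective (le_antisymm (mem_prefixCoalition.1 h₁) (mem_prefixCoalition.1 h₂))

theorem prefixCoalition_eq_initialCoalition (ω : Equiv.Perm (Fin n)) (i : Fin n) :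
    prefixCoalition ω i = initialCoalition ω (ω i + 1) := by
  ext j
  simp only [prefixCoalition, initialCoalition, Finset.mem_filter, Finset.mem_univ, true_and]
  rw [Fin.le_def]
  omega

theorem erase_prefixCoalition (ω : Equiv.Perm (Fin n)) (i : Fin n) :
    (prefixCoalition ω i).erase i = initialCoalition ω (ω i) := by
  ext j
  simp only [Finset.mem_erase, mem_prefixCoalition, initialCoalition, Finset.mem_filter,
    Finset.mem_univ, true_and]
  rw [Ne, ← ω.injective.eq_iff, Fin.ext_iff, Fin.le_def]
  omega

theorem initialCoalition_zero (ω : Equiv.Perm (Fin n)) : initialCoalition ω 0 = ∅ := by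
  simp [initialCoalition]

theorem initialCoalition_self (ω : Equiv.Perm (Fin n)) :
    initialCoalition ω n = Finset.univ := by
  simp [initialCoalition]

/-- The marginal contributions along an order telescope. -/
theorem sum_marginalVector (f : Finset (Fin n) → ℝ) (ω : Equiv.Perm (Fin n)) :
    ∑ i, marginalVector f ω i = f Finset.univ - f ∅ := by
  have h : ∀ i, marginalVector f ω i =
      f (initialCoalition ω (ω i + 1)) - f (initialCoalition ω (ω i)) := fun i => by
    rw [marginalVector, erase_prefixCoalition, prefixCoalition_eq_initialCoalition]
  simp_rw [h]
  rw [Equiv.sum_comp ω fun m : Fin n =>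
      f (initialCoalition ω (m + 1)) - f (initialCoalition ω m),
    Fin.sum_univ_eq_sum_range fun m =>
      f (initialCoalition ω (m + 1)) - f (initialCoalition ω m),
    Finset.sum_range_sub (fun m => f (initialCoalition ω m)), initialCoalition_self,
    initialCoalition_zero]

/-- The marginal vectors of a supermodular function lie above it. -/
theorem le_sum_marginalVector {f : Finset (Fin n) → ℝ} (hf : IsSupermodular f)
    (h₀ : f ∅ = 0) (ω : Equiv.Perm (Fin n)) (S : Finset (Fin n)) :
    f S ≤ ∑ i ∈ S, marginalVector f ω i := by
  -- Telescope `T ↦ f (T ∩ S)` along the order: by supermodularity an agent of `S` adds at most what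
  -- it adds to its whole prefix, and an agent outside `S` adds nothing.
  have key := sum_marginalVector (fun T => f (T ∩ S)) ω
  simp only [Finset.univ_inter, Finset.empty_inter, h₀, sub_zero] at key
  rw [← key, ← Finset.sum_subset (Finset.subset_univ S)]
  · refine Finset.sum_le_sum fun i hi => ?_
    have h := hf ((prefixCoalition ω i).erase i ∩ S) ((prefixCoalition ω i).erase i) i
      Finset.inter_subset_left (by simp)
    rwa [← Finset.insert_inter_of_mem hi,
      Finset.insert_erase (self_mem_prefixCoalition ω i)] at h
  · intro i _ hi
    rw [marginalVector, Finset.erase_inter, Finset.erase_eq_of_notMem (by simp [hi]), sub_self]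

/-- The two exchanged agents both precede `i` or both follow it, so the set of agents up to `i` is
unchanged. -/
theorem prefixCoalition_adjacentFamily (ω : Equiv.Perm (Fin n)) (p i : Fin n)
    (h₁ : ω i ≠ p) (h₂ : (ω i : ℕ) + 1 ≠ p) :
    prefixCoalition (adjacentFamily ω p) i = prefixCoalition ω i := by
  unfold adjacentFamily
  split_ifs with hp
  · rfl
  ext j
  have h₁' : (ω i : ℕ) ≠ p := fun h => h₁ (Fin.ext h)
  have h₃ : ω i ≠ ⟨p.val - 1, lt_of_le_of_lt (Nat.sub_le _ _) p.isLt⟩ := fun h => by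
    have := congrArg Fin.val h
    simp only at this
    omega
  simp only [mem_prefixCoalition, Equiv.trans_apply]
  rw [Equiv.swap_apply_of_ne_of_ne h₃ h₁]
  simp only [Equiv.swap_apply_def, Fin.ext_iff, Fin.le_def]
  split_ifs <;> simp_all <;> omega

/-- The marginal vectors of two adjacent orders differ by a transfer, of size at least the
convexity constant, between the two exchanged agents. -/
theorem exists_marginalVector_adjacentFamily {f : Finset (Fin n) → ℝ} {ς : ℝ}
    (hf : IsStrictlySupermodular ς f) (ω : Equiv.Perm (Fin n)) (m : ℕ) (hm : m + 1 < n) :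
    ∃ g, ς ≤ g ∧ ∀ v : Fin n → ℝ,
      v ⬝ᵥ marginalVector f (adjacentFamily ω ⟨m + 1, hm⟩) - v ⬝ᵥ marginalVector f ω =
        g * (v (ω.symm ⟨m, by omega⟩) - v (ω.symm ⟨m + 1, hm⟩)) := by
  set p : Fin n := ⟨m + 1, hm⟩ with hp
  set q : Fin n := ⟨m, by omega⟩ with hq
  set a := ω.symm q with ha
  set b := ω.symm p with hb
  have hωa : ω a = q := by simp [ha]
  have hωb : ω b = p := by simp [hb]
  have hab : a ≠ b := fun h => by
    have : q = p := by rw [← hωa, ← hωb, h]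
    simp [hp, hq] at this
  set d : Fin n → ℝ := fun i =>
    marginalVector f (adjacentFamily ω p) i - marginalVector f ω i with hd
  have hzero : ∀ i, i ≠ a → i ≠ b → d i = 0 := by
    intro i hia hib
    have h₁ : ω i ≠ p := fun h => hib (by rw [hb, ← h]; simp)
    have h₂ : (ω i : ℕ) + 1 ≠ p := fun h => hia (by
      have : ω i = q := by
        apply Fin.ext
        simp only [hp, hq] at h ⊢
        omega
      rw [ha, ← this]; simp)
    simp only [hd, marginalVector, prefixCoalition_adjacentFamily ω p i h₁ h₂, sub_self]
  have hsum : ∀ w : Fin n → ℝ, ∑ i, w i * d i = w a * d a + w b * d b := by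
    intro w
    rw [← Finset.sum_pair (f := fun i => w i * d i) hab]
    refine (Finset.sum_subset (Finset.subset_univ _) fun i _ hi => ?_).symm
    simp only [Finset.mem_insert, Finset.mem_singleton, not_or] at hi
    rw [hzero i hi.1 hi.2, mul_zero]
  -- Both marginal vectors have the same total, so what one exchanged agent gains the other loses.
  have hbal : d a + d b = 0 := by
    have h := hsum fun _ => 1
    simp only [one_mul] at h
    rw [← h, Finset.sum_sub_distrib, sum_marginalVector, sum_marginalVector, sub_self]
  refine ⟨d a, ?_, fun v => ?_⟩
  -- After the exchange `a` stands last in the old prefix of `b`. It thus joins a coalition strictly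
  -- larger than before, which is where the gap `ς` enters.
  · have hE : prefixCoalition (adjacentFamily ω p) a = prefixCoalition ω b := by
      have hp0 : p.val ≠ 0 := by simp [hp]
      have hpq : (⟨p.val - 1, lt_of_le_of_lt (Nat.sub_le _ _) p.isLt⟩ : Fin n) = q := by
        simp [hp, hq]
      ext j
      simp only [adjacentFamily, hp0, if_false, mem_prefixCoalition, Equiv.trans_apply, hpq, hωa,
        hωb, Equiv.swap_apply_left, Equiv.swap_apply_def, Fin.ext_iff, Fin.le_def]
      simp only [hp, hq]
      split_ifs <;> simp_all
    have hab' : a ∈ prefixCoalition ω b := by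
      rw [mem_prefixCoalition, hωa, hωb, Fin.le_def]; simp [hp, hq]
    have hss : (prefixCoalition ω a).erase a ⊂ (prefixCoalition ω b).erase a := by
      rw [Finset.ssubset_iff_of_subset]
      · refine ⟨b, by simp [hab.symm, self_mem_prefixCoalition], fun h => ?_⟩
        have h := Finset.mem_of_mem_erase h
        rw [mem_prefixCoalition, hωa, hωb, Fin.le_def] at h
        simp [hp, hq] at h
      · refine Finset.erase_subset_erase _ fun j hj => ?_
        rw [mem_prefixCoalition, Fin.le_def] at hj ⊢
        rw [hωa] at hj
        rw [hωb]
        simp only [hp, hq] at hj ⊢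
        omega
    have h := hf.2 _ _ a hss (by simp)
    rw [Finset.insert_erase hab', Finset.insert_erase (self_mem_prefixCoalition ω a)] at h
    simp only [hd, marginalVector, hE]
    linarith
  · have h := hsum v
    simp only [hd, mul_sub, Finset.sum_sub_distrib] at h
    simp only [dotProduct]
    rw [h]
    have hd' : d b = -d a := by linarith
    simp only [hd] at hd' ⊢
    rw [show ∀ x y z w : ℝ, v a * x - v a * y + (v b * z - v b * w) =
      v a * (x - y) + v b * (z - w) by intros; ring, hd']
    ring

/-- The convexity constant is at most `1` if the values lie in `[0, 1]`. -/
theorem strictlySupermodular_constant_le_one {f : Finset (Fin n) → ℝ} {ς : ℝ} (hn : 2 ≤ n)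
    (hf : IsStrictlySupermodular ς f) (h₀ : f ∅ = 0) (hI : ∀ S, f S ∈ Set.Icc (0 : ℝ) 1) :
    ς ≤ 1 := by
  have h := hf.2 ∅ {(⟨0, by omega⟩ : Fin n)} ⟨1, by omega⟩ (by simp) (by simp)
  linarith [(hI (insert ⟨1, by omega⟩ ∅)).1, (hI (insert ⟨1, by omega⟩ {⟨0, by omega⟩})).2,
    (hI {⟨0, by omega⟩}).1]

/-! ### Rewards attributed by a pass -/

theorem passReward_mem_Icc {μN : ℝ} (hμ : μN ∈ Set.Icc (0 : ℝ) 1) (ω : Equiv.Perm (Fin n))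
    (a : Fin n → unitInterval) (S : Finset (Fin n)) :
    passReward μN ω a S ∈ Set.Icc (0 : ℝ) 1 := by
  unfold passReward
  split_ifs with h₁ h₂
  · simp
  · exact hμ
  · by_cases h : ∃ i, prefixCoalition ω i = S
    · obtain ⟨i, rfl⟩ := h
      have : (Finset.univ.filter fun j => prefixCoalition ω j = prefixCoalition ω i) = {i} := by
        ext j
        simp [(prefixCoalition_injective ω).eq_iff]
      rw [this, Finset.sum_singleton]
      exact (a i).2
    · push Not at h
      simp [h]

theorem abs_empiricalMarginal_le_one {μN : ℝ} (hμ : μN ∈ Set.Icc (0 : ℝ) 1)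
    (ω : Equiv.Perm (Fin n)) (a : ℕ → Fin n → unitInterval) (k : ℕ) (i : Fin n) :
    |empiricalMarginal μN ω a k i| ≤ 1 := by
  unfold empiricalMarginal
  rw [abs_mul, abs_of_nonneg (by positivity : (0 : ℝ) ≤ 1 / k)]
  have h : |∑ s ∈ Finset.range k, (passReward μN ω (a s) (prefixCoalition ω i)
      - passReward μN ω (a s) ((prefixCoalition ω i).erase i))| ≤ k := by
    refine (Finset.abs_sum_le_sum_abs _ _).trans ?_
    calc _ ≤ ∑ s ∈ Finset.range k, (1 : ℝ) := Finset.sum_le_sum fun s _ => by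
          have h₁ := passReward_mem_Icc hμ ω (a s) (prefixCoalition ω i)
          have h₂ := passReward_mem_Icc hμ ω (a s) ((prefixCoalition ω i).erase i)
          rw [abs_le]
          constructor <;> linarith [h₁.1, h₁.2, h₂.1, h₂.2]
      _ = k := by simp
  rw [one_div_mul_eq_div]
  exact div_le_one_of_le₀ h (by positivity)

theorem sum_empiricalMarginal (hn : 0 < n) (μN : ℝ) (ω : Equiv.Perm (Fin n))
    (a : ℕ → Fin n → unitInterval) {k : ℕ} (hk : 1 ≤ k) :
    ∑ i, empiricalMarginal μN ω a k i = μN := by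
  have hne : (Finset.univ : Finset (Fin n)) ≠ ∅ :=
    Finset.nonempty_iff_ne_empty.1 ⟨⟨0, hn⟩, Finset.mem_univ _⟩
  have h : ∀ s, ∑ i, (passReward μN ω (a s) (prefixCoalition ω i)
      - passReward μN ω (a s) ((prefixCoalition ω i).erase i)) = μN := fun s => by
    have := sum_marginalVector (passReward μN ω (a s)) ω
    simp only [marginalVector] at this
    rw [this]
    simp [passReward, hne]
  simp only [empiricalMarginal]
  rw [← Finset.mul_sum, Finset.sum_comm]
  simp only [h, Finset.sum_const, Finset.card_range, nsmul_eq_mul]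
  have : (k : ℝ) ≠ 0 := by positivity
  field_simp

/-- The weight of the answer to the query of `P^ω_j` in the marginal contribution of `i`. -/
noncomputable def queryWeight (ω : Equiv.Perm (Fin n)) (i j : Fin n) : ℝ :=
  (if j = i ∧ prefixCoalition ω i ≠ Finset.univ then 1 else 0) -
    if (ω j : ℕ) + 1 = ω i then 1 else 0

theorem sum_queryWeight_sq_le (ω : Equiv.Perm (Fin n)) (i : Fin n) :
    ∑ j, queryWeight ω i j ^ 2 ≤ 2 := by
  have h : ∀ j, queryWeight ω i j ^ 2 ≤
      (if j = i then 1 else 0) + if (ω j : ℕ) + 1 = ω i then 1 else 0 := by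
    intro j
    unfold queryWeight
    split_ifs with h₁ h₂ h₃ <;> simp_all
  have h' : ∑ j, (if (ω j : ℕ) + 1 = ω i then (1 : ℝ) else 0) ≤ 1 := by
    rw [Finset.sum_boole]
    have : (Finset.univ.filter fun j => (ω j : ℕ) + 1 = ω i).card ≤ 1 := by
      rw [Finset.card_le_one]
      intro x hx y hy
      simp only [Finset.mem_filter, Finset.mem_univ, true_and] at hx hy
      exact ω.injective (Fin.ext (by omega))
    exact_mod_cast this
  refine (Finset.sum_le_sum fun j _ => h j).trans ?_
  rw [Finset.sum_add_distrib, Finset.sum_ite_eq']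
  simp only [Finset.mem_univ, if_true]
  linarith

/-- A set function that vanishes at `∅` has marginal contributions that are linear in its values
on the coalitions of the order. -/
theorem marginalVector_eq_sum (f : Finset (Fin n) → ℝ) (h₀ : f ∅ = 0)
    (ω : Equiv.Perm (Fin n)) (i : Fin n) :
    marginalVector f ω i =
      (if prefixCoalition ω i = Finset.univ then f Finset.univ else 0) +
        ∑ j, queryWeight ω i j * f (prefixCoalition ω j) := by
  unfold queryWeight
  simp only [sub_mul, Finset.sum_sub_distrib, ite_mul, one_mul, zero_mul]
  have h₁ : ∑ j, (if j = i ∧ prefixCoalition ω i ≠ Finset.univ then f (prefixCoalition ω j) else 0)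
      = if prefixCoalition ω i = Finset.univ then 0 else f (prefixCoalition ω i) := by
    split_ifs with h <;> simp [h]
  have h₂ : ∑ j, (if (ω j : ℕ) + 1 = ω i then f (prefixCoalition ω j) else 0) =
      f ((prefixCoalition ω i).erase i) := by
    rw [erase_prefixCoalition]
    rcases Nat.eq_zero_or_pos (ω i : ℕ) with h | h
    · rw [h, initialCoalition_zero, h₀]
      simp
    · rw [Finset.sum_eq_single (ω.symm ⟨ω i - 1, by omega⟩)]
      · rw [prefixCoalition_eq_initialCoalition]
        simp [Nat.sub_add_cancel h]
      · intro j _ hj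
        rw [if_neg]
        intro h'
        exact hj (by rw [Equiv.eq_symm_apply]; exact Fin.ext (by simp; omega))
      · simp
  rw [h₁, h₂, marginalVector]
  split_ifs with h
  · rw [h]; ring
  · ring

/-- The answers enter the marginal contributions of a pass through the same weights. -/
theorem marginalVector_passReward (hn : 0 < n) (μN : ℝ) (ω : Equiv.Perm (Fin n))
    (a : Fin n → unitInterval) (i : Fin n) :
    marginalVector (passReward μN ω a) ω i =
      (if prefixCoalition ω i = Finset.univ then μN else 0) +
        ∑ j, queryWeight ω i j * (a j : ℝ) := by
  have hne : (Finset.univ : Finset (Fin n)) ≠ ∅ :=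
    Finset.nonempty_iff_ne_empty.1 ⟨⟨0, hn⟩, Finset.mem_univ _⟩
  rw [marginalVector_eq_sum _ (by simp [passReward])]
  congr 1
  · simp [passReward, hne]
  refine Finset.sum_congr rfl fun j _ => ?_
  have hj : prefixCoalition ω j ≠ ∅ := Finset.ne_empty_of_mem (self_mem_prefixCoalition ω j)
  by_cases hu : prefixCoalition ω j = Finset.univ
  -- The answer for the grand coalition is replaced by the known value, so its weight has to vanish.
  · have : queryWeight ω i j = 0 := by
      have hle : ω i ≤ ω j := mem_prefixCoalition.1 (hu ▸ Finset.mem_univ i)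
      rw [Fin.le_def] at hle
      unfold queryWeight
      rw [if_neg, if_neg (by omega), sub_zero]
      rintro ⟨rfl, h⟩
      exact h hu
    simp [this]
  · simp only [passReward, hj, hu, if_false, (prefixCoalition_injective ω).eq_iff]
    rw [Finset.filter_eq' Finset.univ j, if_pos (Finset.mem_univ j), Finset.sum_singleton]

/-! ### Unit normals and sup-norm errors -/

theorem norm_toLp_eq_one_iff (v : Fin n → ℝ) : ‖WithLp.toLp 2 v‖ = 1 ↔ ∑ i, v i ^ 2 = 1 := by
  have h : ‖WithLp.toLp 2 v‖ ^ 2 = ∑ i, v i ^ 2 := by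
    rw [EuclideanSpace.norm_sq_eq]
    simp
  rw [← h, pow_eq_one_iff_of_nonneg (norm_nonneg _) two_ne_zero]

/-- Hölder's inequality together with ‖v‖₁ ≤ √n ‖v‖₂. A sup-norm error `b` moves values of a unit
functional by at most √n b, half of the offset ε. -/
theorem abs_dotProduct_le {v x : Fin n → ℝ} {b : ℝ} (hv : ‖WithLp.toLp 2 v‖ = 1)
    (hx : ∀ i, |x i| ≤ b) : |v ⬝ᵥ x| ≤ Real.sqrt n * b := by
  rcases Nat.eq_zero_or_pos n with rfl | hn
  · simp [dotProduct]
  have hb : 0 ≤ b := (abs_nonneg _).trans (hx ⟨0, hn⟩)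
  have h₁ : |v ⬝ᵥ x| ≤ (∑ i, |v i|) * b := by
    rw [Finset.sum_mul]
    refine (Finset.abs_sum_le_sum_abs _ _).trans (Finset.sum_le_sum fun i _ => ?_)
    rw [abs_mul]
    exact mul_le_mul_of_nonneg_left (hx i) (abs_nonneg _)
  have h₂ : ∑ i, |v i| ≤ Real.sqrt n := by
    apply Real.le_sqrt_of_sq_le
    have h := sq_sum_le_card_mul_sum_sq (s := Finset.univ) (f := fun i => |v i|)
    simp only [sq_abs, Finset.card_univ, Fintype.card_fin] at h
    rwa [(norm_toLp_eq_one_iff v).1 hv, mul_one] at h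
  exact h₁.trans (mul_le_mul_of_nonneg_right h₂ hb)

/-- Through all points of the family but one there is a hyperplane with a unit normal vector
orthogonal to the diagonal. -/
theorem exists_unit_normal (hn : 2 ≤ n) (Q : Fin n → Fin n → ℝ) (p : Fin n) :
    ∃ (v : Fin n → ℝ) (c : ℝ), ‖WithLp.toLp 2 v‖ = 1 ∧ (∀ q, q ≠ p → v ⬝ᵥ Q q = c) ∧
      v ⬝ᵥ (fun _ => (1 : ℝ)) = 0 := by
  have : Nontrivial (Fin n) := Fin.nontrivial_iff_two_le.2 hn
  obtain ⟨o, ho⟩ := exists_ne p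
  -- A square homogeneous system: row `p` encodes orthogonality to the diagonal, and row `o` is
  -- identically zero. Hence `A` is not surjective, and its kernel is nontrivial.
  let A : (Fin n → ℝ) →ₗ[ℝ] (Fin n → ℝ) :=
    { toFun := fun v q => if q = p then v ⬝ᵥ (fun _ => (1 : ℝ)) else v ⬝ᵥ (Q q - Q o)
      map_add' := fun v w => by
        ext q
        simp only [Pi.add_apply]
        split_ifs <;> rw [add_dotProduct]
      map_smul' := fun t v => by
        ext q
        simp only [Pi.smul_apply, RingHom.id_apply]
        split_ifs <;> rw [smul_dotProduct] }
  have hA : ¬ Function.Injective A := by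
    rw [LinearMap.injective_iff_surjective]
    intro h
    obtain ⟨v, hv⟩ := h fun _ => 1
    have := congrFun hv o
    simp [A, ho] at this
  rw [← LinearMap.ker_eq_bot, Submodule.eq_bot_iff] at hA
  push Not at hA
  obtain ⟨v, hv, hv₀⟩ := hA
  rw [LinearMap.mem_ker] at hv
  have hN : ‖WithLp.toLp 2 v‖ ≠ 0 := by
    rw [norm_ne_zero_iff]
    intro h
    exact hv₀ (by simpa using h)
  refine ⟨‖WithLp.toLp 2 v‖⁻¹ • v, (‖WithLp.toLp 2 v‖⁻¹ • v) ⬝ᵥ Q o, ?_, fun q hq => ?_, ?_⟩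
  · rw [WithLp.toLp_smul, norm_smul, norm_inv, norm_norm, inv_mul_cancel₀ hN]
  · have h := congrFun hv q
    simp only [A, LinearMap.coe_mk, AddHom.coe_mk, hq, if_false, Pi.zero_apply,
      dotProduct_sub] at h
    rw [smul_dotProduct, smul_dotProduct, sub_eq_zero.1 h]
  · have h := congrFun hv p
    simp only [A, LinearMap.coe_mk, AddHom.coe_mk, if_true, Pi.zero_apply] at h
    rw [smul_dotProduct, h, smul_zero]

theorem abs_sub_le_mul_of_abs_succ_sub_le {u : Fin n → ℝ} {B : ℝ}
    (hu : ∀ (m : ℕ) (hm : m + 1 < n), |u ⟨m, by omega⟩ - u ⟨m + 1, hm⟩| ≤ B) (l m : Fin n)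
    (hlm : l ≤ m) : |u l - u m| ≤ (m - l : ℝ) * B := by
  obtain ⟨m, hm⟩ := m
  obtain ⟨l, hl⟩ := l
  simp only [Fin.mk_le_mk] at hlm
  induction m, hlm using Nat.le_induction with
  | base => simp
  | succ m hlm ih =>
    have h₁ := ih (by omega)
    have h₂ := hu m hm
    have h₃ := abs_sub_le (u ⟨l, hl⟩) (u ⟨m, by omega⟩) (u ⟨m + 1, hm⟩)
    push_cast at h₁ ⊢
    linarith

/-- A vector with zero sum and small increments is small. -/
theorem abs_le_mul_of_abs_succ_sub_le {u : Fin n → ℝ} {B : ℝ} (hB : 0 ≤ B)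
    (hu : ∀ (m : ℕ) (hm : m + 1 < n), |u ⟨m, by omega⟩ - u ⟨m + 1, hm⟩| ≤ B)
    (h₀ : ∑ i, u i = 0) (l : Fin n) : |u l| ≤ n * B := by
  have hn : (0 : ℝ) < n := by exact_mod_cast l.pos
  have h : ∀ m, |u l - u m| ≤ n * B := by
    intro m
    have hl : ((l : ℕ) : ℝ) ≤ n := by exact_mod_cast l.isLt.le
    have hm : ((m : ℕ) : ℝ) ≤ n := by exact_mod_cast m.isLt.le
    rcases le_total l m with hlm | hlm
    · refine (abs_sub_le_mul_of_abs_succ_sub_le hu l m hlm).trans ?_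
      exact mul_le_mul_of_nonneg_right (by linarith [Nat.cast_nonneg (α := ℝ) (l : ℕ)]) hB
    · rw [abs_sub_comm]
      refine (abs_sub_le_mul_of_abs_succ_sub_le hu m l hlm).trans ?_
      exact mul_le_mul_of_nonneg_right (by linarith [Nat.cast_nonneg (α := ℝ) (m : ℕ)]) hB
  have hs : ∑ m, (u l - u m) = n * u l := by
    rw [Finset.sum_sub_distrib, h₀]
    simp
  have h' : |∑ m, (u l - u m)| ≤ n * (n * B) := by
    refine (Finset.abs_sum_le_sum_abs _ _).trans ((Finset.sum_le_sum fun m _ => h m).trans ?_)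
    simp
  rw [hs, abs_mul, abs_of_pos hn] at h'
  exact le_of_mul_le_mul_left h' hn

/-! ### Precise estimates pass the stopping test -/

/-- Well separated simplices: if estimates of the marginal vectors of adjacent orders are precise,
every estimate is far from the hyperplane through the others. -/
theorem le_abs_gap {f : Finset (Fin n) → ℝ} {ς b : ℝ} (hn : 2 ≤ n) (hς : 0 < ς)
    (hf : IsStrictlySupermodular ς f) (ω : Equiv.Perm (Fin n)) {Q : Fin n → Fin n → ℝ}
    (hb : b < ς / (6 * (n : ℝ) ^ 3))
    (hQ : ∀ p i, |Q p i - marginalVector f (adjacentFamily ω p) i| ≤ b)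
    {p : Fin n} {v : Fin n → ℝ} {c : ℝ} (hv : ‖WithLp.toLp 2 v‖ = 1)
    (hc : ∀ q, q ≠ p → v ⬝ᵥ Q q = c) (h₁ : v ⬝ᵥ (fun _ => (1 : ℝ)) = 0) :
    ((n : ℝ) + 3 / 2) * (2 * Real.sqrt n * b) ≤ |c - v ⬝ᵥ Q p| := by
  by_contra! hlt
  have hn' : (2 : ℝ) ≤ n := by exact_mod_cast hn
  have hb₀ : 0 ≤ b := (abs_nonneg _).trans (hQ p p)
  set s := Real.sqrt n with hs
  have hs₀ : 0 ≤ s := Real.sqrt_nonneg _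
  have hs₂ : s ^ 2 = n := Real.sq_sqrt (by linarith)
  have hsb : 0 ≤ s * b := mul_nonneg hs₀ hb₀
  let o : Fin n := ⟨0, by omega⟩
  have hQc : ∀ q, |c - v ⬝ᵥ Q q| ≤ |c - v ⬝ᵥ Q p| := by
    intro q
    by_cases hq : q = p
    · rw [hq]
    · rw [hc q hq, sub_self, abs_zero]
      exact abs_nonneg _
  -- Only `Q p` is off the hyperplane, so `v` varies over the whole family by at most the gap.
  have hQQ : ∀ q, |v ⬝ᵥ Q q - v ⬝ᵥ Q o| ≤ |c - v ⬝ᵥ Q p| := by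
    intro q
    by_cases hq : q = p
    · by_cases ho : o = p
      · rw [hq, ho, sub_self, abs_zero]
        exact abs_nonneg _
      · rw [hc o ho, hq, abs_sub_comm]
    · rw [hc q hq]
      exact hQc o
  have hφ : ∀ q, |v ⬝ᵥ Q q - v ⬝ᵥ marginalVector f (adjacentFamily ω q)| ≤ s * b := by
    intro q
    rw [← dotProduct_sub]
    exact abs_dotProduct_le hv fun i => hQ q i
  have hadj : adjacentFamily ω o = ω := by simp [adjacentFamily, o]
  have hstep : ∀ (m : ℕ) (hm : m + 1 < n),
      |v (ω.symm ⟨m, by omega⟩) - v (ω.symm ⟨m + 1, hm⟩)| ≤ 6 * n * (s * b) / ς := by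
    intro m hm
    obtain ⟨g, hg, h⟩ := exists_marginalVector_adjacentFamily hf ω m hm
    have hv' := h v
    have e₁ := hφ ⟨m + 1, hm⟩
    have e₂ := hφ o
    have e₃ := hQQ ⟨m + 1, hm⟩
    rw [hadj] at e₂
    have hd : |v ⬝ᵥ marginalVector f (adjacentFamily ω ⟨m + 1, hm⟩) - v ⬝ᵥ marginalVector f ω| ≤
        6 * n * (s * b) := by
      -- The gap plus two estimation errors is (2n + 5) √n b, and 5 ≤ 4n.
      have : ((n : ℝ) + 3 / 2) * (2 * s * b) + 2 * (s * b) ≤ 6 * n * (s * b) := by nlinarith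
      rw [abs_le] at e₁ e₂ e₃ ⊢
      constructor <;> linarith [e₁.1, e₁.2, e₂.1, e₂.2, e₃.1, e₃.2]
    rw [hv', abs_mul, abs_of_nonneg (hς.le.trans hg)] at hd
    rw [le_div_iff₀ hς, mul_comm]
    exact (mul_le_mul_of_nonneg_right hg (abs_nonneg _)).trans hd
  have hsum : ∑ i, v (ω.symm i) = 0 := by
    rw [Equiv.sum_comp ω.symm v]
    simpa [dotProduct] using h₁
  have hsmall : ∀ i, |v i| ≤ n * (6 * n * (s * b) / ς) := by
    intro i
    have h := abs_le_mul_of_abs_succ_sub_le (u := fun m => v (ω.symm m))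
      (by positivity) hstep hsum (ω i)
    simpa using h
  have hone := (norm_toLp_eq_one_iff v).1 hv
  have hle : (1 : ℝ) ≤ n * (n * (6 * n * (s * b) / ς)) ^ 2 := by
    rw [← hone]
    calc ∑ i, v i ^ 2 ≤ ∑ _i : Fin n, (n * (6 * n * (s * b) / ς)) ^ 2 :=
          Finset.sum_le_sum fun i _ => by
            rw [← sq_abs]
            exact pow_le_pow_left₀ (abs_nonneg _) (hsmall i) 2
      _ = _ := by simp
  -- The entries of `v` are at most 6n²√n b/ς, so ‖v‖² ≤ (6n³b/ς)²; this fixes the threshold for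
  -- `b`.
  have hr : (n : ℝ) * (n * (6 * n * (s * b) / ς)) ^ 2 = (6 * n ^ 3 * b / ς) ^ 2 := by
    have : (n : ℝ) * (n * (6 * n * (s * b) / ς)) ^ 2 = n * s ^ 2 * (6 * n ^ 2 * b / ς) ^ 2 := by
      ring
    rw [this, hs₂]
    ring
  have hlt₁ : 6 * (n : ℝ) ^ 3 * b / ς < 1 := by
    rw [div_lt_one hς]
    rw [lt_div_iff₀ (by positivity)] at hb
    linarith
  rw [hr] at hle
  have h0 : 0 ≤ 6 * (n : ℝ) ^ 3 * b / ς := by positivity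
  nlinarith

/-- Precise estimates of the marginal vectors of adjacent orders pass the stopping test. -/
theorem stoppingCondition_of_abs_sub_le {f : Finset (Fin n) → ℝ} {ς b : ℝ} (hn : 2 ≤ n)
    (hς : 0 < ς) (hf : IsStrictlySupermodular ς f) (ω : Equiv.Perm (Fin n))
    {Q : Fin n → Fin n → ℝ} (hb₀ : 0 < b) (hb : b < ς / (6 * (n : ℝ) ^ 3))
    (hQ : ∀ p i, |Q p i - marginalVector f (adjacentFamily ω p) i| ≤ b) :
    StoppingCondition Q b := by
  intro p
  have hn' : (2 : ℝ) ≤ n := by exact_mod_cast hn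
  set s := Real.sqrt n with hs
  have hs₀ : 0 < s := Real.sqrt_pos.2 (by linarith)
  have hsb : 0 < s * b := mul_pos hs₀ hb₀
  have hnsb : 0 < n * (s * b) := by positivity
  -- Orient the normal so that `Q p` is on the lower side. Of the gap (n + 3/2) ε, the offset takes
  -- ε and the ball around `Q p` takes ε/2, which leaves the required n ε.
  obtain ⟨v, c, hv, hc, h₁, hgap⟩ : ∃ (v : Fin n → ℝ) (c : ℝ), ‖WithLp.toLp 2 v‖ = 1 ∧
      (∀ q, q ≠ p → v ⬝ᵥ Q q = c) ∧ v ⬝ᵥ (fun _ => (1 : ℝ)) = 0 ∧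
      ((n : ℝ) + 3 / 2) * (2 * s * b) ≤ c - v ⬝ᵥ Q p := by
    obtain ⟨v, c, hv, hc, h₁⟩ := exists_unit_normal hn Q p
    have h := le_abs_gap hn hς hf ω hb hQ hv hc h₁
    rcases le_abs.1 h with h | h
    · exact ⟨v, c, hv, hc, h₁, h⟩
    · refine ⟨-v, -c, by simpa using hv, fun q hq => ?_, ?_, ?_⟩
      · rw [neg_dotProduct, hc q hq]
      · rw [neg_dotProduct, h₁, neg_zero]
      · rw [neg_dotProduct]
        linarith
  refine ⟨v, c - 2 * s * b, ⟨hv, fun q hq => ?_, ?_, h₁⟩, ?_⟩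
  · rw [hc q hq]
    ring
  · nlinarith
  · unfold hyperplaneDistance
    refine le_csInf ⟨_, Q p, by simpa using hb₀, rfl⟩ ?_
    rintro _ ⟨x, hx, rfl⟩
    have hxv : |v ⬝ᵥ (x - Q p)| ≤ s * b := by
      refine abs_dotProduct_le hv fun i => ?_
      exact (norm_le_pi_norm (x - Q p) i).trans (le_of_lt hx)
    rw [dotProduct_sub, abs_le] at hxv
    simp only
    nlinarith [hxv.2]

/-! ### Consequences of a passed test -/

/-- A hyperplane that passes the stopping test is far from the opposite point. -/
theorem le_sub_of_le_hyperplaneDistance {Q : Fin n → Fin n → ℝ} {b t : ℝ} {p : Fin n}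
    {v : Fin n → ℝ} {c : ℝ} (hb : 0 < b) (hv : ‖WithLp.toLp 2 v‖ = 1)
    (h : t ≤ hyperplaneDistance Q b p v c) : t ≤ c - v ⬝ᵥ Q p := by
  -- The real `sInf` of a set unbounded below is 0, so a lower bound on the ball must be supplied.
  refine h.trans (csInf_le ⟨c - v ⬝ᵥ Q p - Real.sqrt n * b, ?_⟩ ⟨Q p, by simpa using hb, rfl⟩)
  rintro _ ⟨x, hx, rfl⟩
  have hxv : |v ⬝ᵥ (x - Q p)| ≤ Real.sqrt n * b := by
    refine abs_dotProduct_le hv fun i => ?_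
    exact (norm_le_pi_norm (x - Q p) i).trans (le_of_lt hx)
  rw [dotProduct_sub, abs_le] at hxv
  simp only
  linarith [hxv.2]

/-- The stopping test fails while the confidence bonus is large. -/
theorem StoppingCondition.bonus_le {Q : Fin n → Fin n → ℝ} {b : ℝ} (hn : 2 ≤ n)
    (h : StoppingCondition Q b) (hb : 0 < b) (hQ : ∀ p i, |Q p i| ≤ 1) :
    ((n : ℝ) + 1) * b ≤ 1 := by
  obtain ⟨v, c, ⟨hv, hc, -, -⟩, hd⟩ := h ⟨0, by omega⟩
  have hd := le_sub_of_le_hyperplaneDistance hb hv hd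
  have hc := hc ⟨1, by omega⟩ (by simp)
  have hle : |v ⬝ᵥ (Q ⟨1, by omega⟩ - Q ⟨0, by omega⟩)| ≤ Real.sqrt n * 2 := by
    refine abs_dotProduct_le hv fun i => ?_
    have h₁ := hQ ⟨1, by omega⟩ i
    have h₂ := hQ ⟨0, by omega⟩ i
    exact (abs_sub _ _).trans (by linarith)
  rw [dotProduct_sub, abs_le] at hle
  have hs : 0 < Real.sqrt n := Real.sqrt_pos.2 (by exact_mod_cast (by omega : 0 < n))
  have hfin : Real.sqrt n * (((n : ℝ) + 1) * b) ≤ Real.sqrt n * 1 := by nlinarith [hle.2]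
  exact le_of_mul_le_mul_left hfin hs

/-- Barycentric coordinates with respect to points that are separated from one another by
hyperplanes orthogonal to the hyperplane that contains all of them. -/
theorem exists_barycentric (hn : 0 < n) {Q : Fin n → Fin n → ℝ} {M : ℝ}
    (hM : ∀ p, ∑ i, Q p i = M) {v : Fin n → Fin n → ℝ} {c : Fin n → ℝ}
    (hc : ∀ p q, q ≠ p → v p ⬝ᵥ Q q = c p) (hlt : ∀ p, v p ⬝ᵥ Q p < c p)
    (h₁ : ∀ p, v p ⬝ᵥ (fun _ => (1 : ℝ)) = 0) {y : Fin n → ℝ} (hy : ∑ i, y i = M) :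
    ∃ t : Fin n → ℝ, ∑ q, t q = 1 ∧ y = ∑ q, t q • Q q ∧
      ∀ p, (c p - v p ⬝ᵥ Q p) * t p = c p - v p ⬝ᵥ y := by
  -- All `Q q` lie in a hyperplane of constant sum; the extra direction along the diagonal makes the
  -- system square. The functionals `v p` ignore that direction and recover the coordinates, so `R`
  -- is bijective. Comparing sums shows that the diagonal part of the solution is zero.
  let R : (Fin n → ℝ) × ℝ →ₗ[ℝ] (Fin n → ℝ) × ℝ :=
    { toFun := fun z => (∑ q, z.1 q • Q q + z.2 • (fun _ => (1 : ℝ)), ∑ q, z.1 q)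
      map_add' := fun z w => by
        ext
        · simp [add_mul, Finset.sum_add_distrib]
          ring
        · simp [Finset.sum_add_distrib]
      map_smul' := fun a z => by
        ext
        · simp [Finset.mul_sum, mul_assoc]
        · simp [Finset.mul_sum] }
  have hcoord : ∀ (z : (Fin n → ℝ) × ℝ) (p : Fin n),
      c p * (R z).2 - v p ⬝ᵥ (R z).1 = (c p - v p ⬝ᵥ Q p) * z.1 p := by
    intro z p
    have : v p ⬝ᵥ (R z).1 = ∑ q, z.1 q * (v p ⬝ᵥ Q q) := by
      simp only [R, LinearMap.coe_mk, AddHom.coe_mk, dotProduct_add, dotProduct_smul, h₁,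
        dotProduct_sum, smul_eq_mul, mul_zero, add_zero]
    rw [this]
    simp only [R, LinearMap.coe_mk, AddHom.coe_mk]
    rw [Finset.mul_sum, ← Finset.sum_sub_distrib, Finset.sum_eq_single p]
    · ring
    · intro q _ hq
      rw [hc p q hq]
      ring
    · simp
  have hinj : Function.Injective R := by
    rw [← LinearMap.ker_eq_bot, Submodule.eq_bot_iff]
    intro z hz
    rw [LinearMap.mem_ker] at hz
    have hz₁ : z.1 = 0 := by
      ext p
      have h := hcoord z p
      rw [hz] at h
      simp only [Prod.snd_zero, Prod.fst_zero, mul_zero, dotProduct_zero, sub_zero] at h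
      exact (mul_eq_zero.1 h.symm).resolve_left (sub_pos.2 (hlt p)).ne'
    have hz₂ : z.2 = 0 := by
      have h := congrFun (congrArg Prod.fst hz) ⟨0, hn⟩
      simpa [R, hz₁] using h
    exact Prod.ext hz₁ hz₂
  obtain ⟨z, hz⟩ := (LinearMap.injective_iff_surjective.1 hinj) (y, 1)
  have hz₁ : ∑ q, z.1 q • Q q + z.2 • (fun _ => (1 : ℝ)) = y := congrArg Prod.fst hz
  have hz₂ : ∑ q, z.1 q = 1 := congrArg Prod.snd hz
  have hz₀ : z.2 = 0 := by
    have h : ∑ i, y i = ∑ q, z.1 q * M + n * z.2 := by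
      rw [← hz₁]
      simp only [Pi.add_apply, Finset.sum_apply, Pi.smul_apply, smul_eq_mul, mul_one,
        Finset.sum_add_distrib]
      rw [Finset.sum_comm]
      simp [← Finset.mul_sum, hM]
    rw [← Finset.sum_mul, hz₂, hy, one_mul] at h
    have : (n : ℝ) ≠ 0 := by positivity
    simpa [this] using h
  refine ⟨z.1, hz₂, ?_, fun p => ?_⟩
  · rw [← hz₁, hz₀, zero_smul, add_zero]
  · rw [← hcoord z p, hz, mul_one]

/-- The average of estimates that pass the stopping test satisfies every linear inequality that
holds at points within the confidence bonus of the estimates. -/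
theorem StoppingCondition.le_dotProduct_average (hn : 0 < n) {Q φ : Fin n → Fin n → ℝ}
    {b M : ℝ} (h : StoppingCondition Q b) (hb : 0 < b) (hM : ∀ p, ∑ i, Q p i = M)
    (hφM : ∀ p, ∑ i, φ p i = M) (hφ : ∀ p i, |Q p i - φ p i| ≤ b) {w : Fin n → ℝ} {t : ℝ}
    (hw : ∀ q, t ≤ w ⬝ᵥ φ q) :
    t ≤ w ⬝ᵥ fun i => (1 / (n : ℝ)) * ∑ p, Q p i := by
  choose v c hvc using h
  have hn₀ : (0 : ℝ) < n := by exact_mod_cast hn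
  set s := Real.sqrt n with hs
  have hs₀ : 0 < s := Real.sqrt_pos.2 hn₀
  have hsb : 0 < s * b := mul_pos hs₀ hb
  have hv : ∀ p, ‖WithLp.toLp 2 (v p)‖ = 1 := fun p => (hvc p).1.1
  -- Seen from the hyperplane itself, the gap is nε plus the offset ε.
  have hgap : ∀ p, 2 * ((n : ℝ) + 1) * (s * b) ≤ (c p + 2 * s * b) - v p ⬝ᵥ Q p := fun p => by
    have := le_sub_of_le_hyperplaneDistance hb (hv p) (hvc p).2
    linarith
  have hη : ∀ q, ∃ d : Fin n → ℝ, ∑ p, d p = 1 ∧ φ q = ∑ p, d p • Q p ∧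
      ∀ p, 2 * ((n : ℝ) + 1) * |d p - if p = q then 1 else 0| ≤ 1 := by
    intro q
    obtain ⟨d, hd₁, hd₂, hd₃⟩ := exists_barycentric hn hM (fun p => (hvc p).1.2.1)
      (fun p => (hvc p).1.2.2.1) (fun p => (hvc p).1.2.2.2) (hφM q)
    refine ⟨d, hd₁, hd₂, fun p => ?_⟩
    have hle : |v p ⬝ᵥ (Q q - φ q)| ≤ s * b := abs_dotProduct_le (hv p) fun i => hφ q i
    have heq : ((c p + 2 * s * b) - v p ⬝ᵥ Q p) * (d p - if p = q then 1 else 0) =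
        v p ⬝ᵥ (Q q - φ q) := by
      rw [mul_sub, hd₃ p, dotProduct_sub]
      split_ifs with hpq
      · rw [hpq]
        ring
      · rw [(hvc p).1.2.1 q (Ne.symm hpq)]
        ring
    rw [← heq, abs_mul, abs_of_nonneg (le_trans (by positivity) (hgap p))] at hle
    have h₃ := (mul_le_mul_of_nonneg_right (hgap p)
      (abs_nonneg (d p - if p = q then 1 else 0))).trans hle
    refine le_of_mul_le_mul_left ?_ hsb
    linarith
  set L : Fin n → ℝ := fun p => w ⬝ᵥ Q p - t with hL
  set A := ∑ p, |L p| with hA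
  have hA₀ : 0 ≤ A := Finset.sum_nonneg fun _ _ => abs_nonneg _
  -- Expanding `φ q` in the `Q p` gives 0 ≤ L q + A / (2(n + 1)), so the negative part of each `L q`
  -- is small. Summing over `q` yields (n + 1) ∑ L ≥ A ≥ 0.
  have hLq : ∀ q, 2 * ((n : ℝ) + 1) * (|L q| - L q) ≤ 2 * A := by
    intro q
    obtain ⟨d, hd₁, hd₂, hd₃⟩ := hη q
    have h0 : 0 ≤ ∑ p, d p * L p := by
      have : ∑ p, d p * L p = w ⬝ᵥ φ q - t := by
        simp only [hL, mul_sub, Finset.sum_sub_distrib, ← Finset.sum_mul, hd₁, one_mul]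
        rw [hd₂, dotProduct_sum]
        simp [dotProduct_smul]
      rw [this]
      linarith [hw q]
    have h1 : ∑ p, d p * L p = L q + ∑ p, (d p - if p = q then 1 else 0) * L p := by
      simp [sub_mul, Finset.sum_sub_distrib]
    have h2 : 2 * ((n : ℝ) + 1) * ∑ p, (d p - if p = q then 1 else 0) * L p ≤ A := by
      rw [Finset.mul_sum]
      refine Finset.sum_le_sum fun p _ => ?_
      calc _ ≤ |2 * ((n : ℝ) + 1) * ((d p - if p = q then 1 else 0) * L p)| := le_abs_self _
        _ = (2 * ((n : ℝ) + 1) * |d p - if p = q then 1 else 0|) * |L p| := by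
          rw [abs_mul, abs_of_pos (by positivity : 0 < 2 * ((n : ℝ) + 1)), abs_mul]
          ring
        _ ≤ 1 * |L p| := mul_le_mul_of_nonneg_right (hd₃ p) (abs_nonneg _)
        _ = |L p| := one_mul _
    rcases abs_cases (L q) with ⟨h, -⟩ | ⟨h, -⟩
    · rw [h, sub_self, mul_zero]
      linarith
    · rw [h]
      have h3 : 0 ≤ 2 * ((n : ℝ) + 1) * (L q + ∑ p, (d p - if p = q then 1 else 0) * L p) :=
        mul_nonneg (by positivity) (h1 ▸ h0)
      linarith
  have hsum : 0 ≤ ∑ p, L p := by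
    have h := Finset.sum_le_sum fun q (_ : q ∈ Finset.univ) => hLq q
    rw [← Finset.mul_sum, Finset.sum_sub_distrib, ← hA] at h
    simp only [Finset.sum_const, Finset.card_univ, Fintype.card_fin, nsmul_eq_mul] at h
    by_contra! hneg
    nlinarith
  have havg : w ⬝ᵥ (fun i => (1 / (n : ℝ)) * ∑ p, Q p i) = (1 / (n : ℝ)) * ∑ p, w ⬝ᵥ Q p := by
    simp only [dotProduct, Finset.mul_sum]
    rw [Finset.sum_comm]
    exact Finset.sum_congr rfl fun _ _ => Finset.sum_congr rfl fun _ _ => by ring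
  rw [havg, one_div, ← div_eq_inv_mul, le_div_iff₀ hn₀]
  simp only [hL, Finset.sum_sub_distrib, Finset.sum_const, Finset.card_univ, Fintype.card_fin,
    nsmul_eq_mul] at hsum
  linarith

/-! ### Concentration of the estimates -/

theorem hasSubgaussianMGF_mono {Ω : Type*} [MeasurableSpace Ω] {Pr : Measure Ω} {X : Ω → ℝ}
    {c d : NNReal} (h : HasSubgaussianMGF X c Pr) (hcd : c ≤ d) : HasSubgaussianMGF X d Pr where
  integrable_exp_mul := h.integrable_exp_mul
  mgf_le t := (h.mgf_le t).trans <| by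
    have : (c : ℝ) ≤ d := hcd
    gcongr

/-- A bounded reward with mean `μ(S)` is sub-Gaussian. -/
theorem hasSubgaussianMGF_answer {Ω : Type*} [MeasurableSpace Ω] {Pr : Measure Ω}
    [IsProbabilityMeasure Pr] (G : StochasticGame n) (S : Finset (Fin n)) {a : Ω → unitInterval}
    (ha : HasLaw a (G.reward S : Measure unitInterval) Pr) :
    HasSubgaussianMGF (fun z => (a z : ℝ) - G.expectedReward S) ((1 / 2) ^ 2) Pr := by
  have hm : AEMeasurable (fun z => (a z : ℝ)) Pr :=
    measurable_subtype_coe.comp_aemeasurable ha.aemeasurable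
  have h := hasSubgaussianMGF_of_mem_Icc (a := 0) (b := 1) hm
    (Filter.Eventually.of_forall fun z => (a z).2)
  have hE : ∫ z, (a z : ℝ) ∂Pr = G.expectedReward S := by
    unfold StochasticGame.expectedReward
    rw [← ha.map_eq, integral_map ha.aemeasurable
      measurable_subtype_coe.aestronglyMeasurable]
  rw [hE] at h
  simpa using h

/-- Hoeffding's inequality for the empirical marginal contributions along an order. -/
theorem measureReal_le_abs_empiricalMarginal_sub {Ω : Type*} [MeasurableSpace Ω]
    {Pr : Measure Ω} [IsProbabilityMeasure Pr] (G : StochasticGame n)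
    (h₀ : G.expectedReward ∅ = 0) (ω : Equiv.Perm (Fin n)) {a : ℕ → Fin n → Ω → unitInterval}
    (ha : ∀ s j, HasLaw (a s j) (G.reward (prefixCoalition ω j) : Measure unitInterval) Pr)
    (hind : iIndepFun (fun k : ℕ × Fin n => a k.1 k.2) Pr) (i : Fin n) {k : ℕ} (hk : 1 ≤ k)
    {b : ℝ} (hb : 0 ≤ b) :
    Pr.real {z | b ≤ |empiricalMarginal (G.expectedReward Finset.univ) ω (fun s j => a s j z) k i
      - marginalVector G.expectedReward ω i|} ≤ 2 * Real.exp (-(k * b ^ 2)) := by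
  have hk' : (0 : ℝ) < k := by exact_mod_cast hk
  let X : ℕ × Fin n → Ω → ℝ := fun l z =>
    queryWeight ω i l.2 * ((a l.1 l.2 z : ℝ) - G.expectedReward (prefixCoalition ω l.2))
  have hX : iIndepFun X Pr :=
    hind.comp (fun l x => queryWeight ω i l.2 *
      ((x : ℝ) - G.expectedReward (prefixCoalition ω l.2))) fun l => by fun_prop
  have hXl : ∀ l, HasSubgaussianMGF (X l) (‖queryWeight ω i l.2‖₊ ^ 2 * (1 / 2) ^ 2) Pr := by
    intro l
    have h := (hasSubgaussianMGF_answer G _ (ha l.1 l.2)).const_mul (queryWeight ω i l.2)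
    have hc : ‖queryWeight ω i l.2‖₊ ^ 2 = NNReal.mk (queryWeight ω i l.2 ^ 2) (sq_nonneg _) := by
      ext
      simp
    rw [hc]
    exact h
  have hsub := HasSubgaussianMGF.sum_of_iIndepFun hX (s := Finset.range k ×ˢ Finset.univ)
    fun l _ => hXl l
  -- Each answer has variance proxy 1/4 and the squared weights of a pass sum to at most 2, which
  -- gives k/2 over k epochs.
  have hsub := hasSubgaussianMGF_mono (d := k / 2) hsub <| by
    rw [Finset.sum_product, ← NNReal.coe_le_coe]
    push_cast
    simp only [Real.norm_eq_abs, sq_abs]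
    rw [← Finset.sum_mul, Finset.sum_const, Finset.card_range, nsmul_eq_mul]
    have := sum_queryWeight_sq_le ω i
    nlinarith
  have hsum : ∀ z, ∑ l ∈ Finset.range k ×ˢ Finset.univ, X l z =
      k * (empiricalMarginal (G.expectedReward Finset.univ) ω (fun s j => a s j z) k i
        - marginalVector G.expectedReward ω i) := by
    intro z
    have hs : ∀ s, ∑ j, X (s, j) z =
        marginalVector (passReward (G.expectedReward Finset.univ) ω (fun j => a s j z)) ω i -
          marginalVector G.expectedReward ω i := by
      intro s
      rw [marginalVector_passReward i.pos, marginalVector_eq_sum _ h₀]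
      simp only [X, mul_sub, Finset.sum_sub_distrib]
      ring
    rw [Finset.sum_product, Finset.sum_congr rfl fun s _ => hs s, Finset.sum_sub_distrib]
    simp only [empiricalMarginal, marginalVector, Finset.sum_const, Finset.card_range,
      nsmul_eq_mul]
    field_simp
  have hbd : ∀ Y : Ω → ℝ, HasSubgaussianMGF Y (k / 2) Pr →
      Pr.real {z | k * b ≤ Y z} ≤ Real.exp (-(k * b ^ 2)) := by
    intro Y hY
    refine (hY.measure_ge_le (by positivity)).trans (le_of_eq ?_)
    congr 1
    push_cast
    field_simp
  have hsub' := hsub.neg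
  calc _ ≤ Pr.real ({z | k * b ≤ ∑ l ∈ Finset.range k ×ˢ Finset.univ, X l z} ∪
        {z | k * b ≤ -∑ l ∈ Finset.range k ×ˢ Finset.univ, X l z}) := by
        refine measureReal_mono fun z hz => ?_
        simp only [Set.mem_union, Set.mem_ofPred_eq, hsum, ← mul_neg,
          mul_le_mul_iff_right₀ hk'] at hz ⊢
        exact le_abs.1 hz
    _ ≤ _ := by
        refine (measureReal_union_le _ _).trans ?_
        have h₁ := hbd _ hsub
        have h₂ := hbd _ hsub'
        simp only [Pi.neg_apply] at h₂
        linarith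

/-! ### The confidence bonus and the union bound over epochs -/

theorem two_le_natCast_mul_mul_inv (hn : 2 ≤ n) {δ : ℝ} (hδ : 0 < δ) (hδ₁ : δ ≤ 1) {k : ℕ}
    (hk : 1 ≤ k) : (2 : ℝ) ≤ n * k * δ⁻¹ := by
  have h₁ : (2 : ℝ) ≤ n := by exact_mod_cast hn
  have h₂ : (1 : ℝ) ≤ k := by exact_mod_cast hk
  have h₃ : 1 ≤ δ⁻¹ := (one_le_inv₀ hδ).2 hδ₁
  calc (2 : ℝ) = 2 * 1 * 1 := by norm_num
    _ ≤ n * k * δ⁻¹ := by gcongr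

theorem confidenceBonus_sq (hn : 2 ≤ n) {δ : ℝ} (hδ : 0 < δ) (hδ₁ : δ ≤ 1) {k : ℕ}
    (hk : 1 ≤ k) : confidenceBonus n δ k ^ 2 = 2 * Real.log (n * k * δ⁻¹) / k := by
  refine Real.sq_sqrt ?_
  have := Real.log_nonneg (by linarith [two_le_natCast_mul_mul_inv hn hδ hδ₁ hk] :
    (1 : ℝ) ≤ n * k * δ⁻¹)
  positivity

theorem confidenceBonus_pos (hn : 2 ≤ n) {δ : ℝ} (hδ : 0 < δ) (hδ₁ : δ ≤ 1) {k : ℕ}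
    (hk : 1 ≤ k) : 0 < confidenceBonus n δ k := by
  refine Real.sqrt_pos.2 ?_
  have := Real.log_pos (by linarith [two_le_natCast_mul_mul_inv hn hδ hδ₁ hk] :
    (1 : ℝ) < n * k * δ⁻¹)
  positivity

/-- The stopping test fails in the first two epochs. -/
theorem StoppingCondition.three_le {Q : Fin n → Fin n → ℝ} {δ : ℝ} {k : ℕ} (hn : 2 ≤ n)
    (hδ : 0 < δ) (hδ₁ : δ ≤ 1) (hk : 1 ≤ k) (h : StoppingCondition Q (confidenceBonus n δ k))
    (hQ : ∀ p i, |Q p i| ≤ 1) : 3 ≤ k := by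
  by_contra! hlt
  have hpos := confidenceBonus_pos hn hδ hδ₁ hk
  have hle := h.bonus_le hn hpos hQ
  have hsq := confidenceBonus_sq hn hδ hδ₁ hk
  have hlog : Real.log 2 ≤ Real.log (n * k * δ⁻¹) :=
    Real.log_le_log (by norm_num) (two_le_natCast_mul_mul_inv hn hδ hδ₁ hk)
  have hn' : (2 : ℝ) ≤ n := by exact_mod_cast hn
  have hk₂ : (k : ℝ) ≤ 2 := by exact_mod_cast (by omega : k ≤ 2)
  have hk₁ : (0 : ℝ) < k := by exact_mod_cast hk
  rw [eq_div_iff hk₁.ne'] at hsq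
  -- A passed test forces (n + 1) b ≤ 1, whereas b² ≥ log 2 when k ≤ 2.
  have h₃ : confidenceBonus n δ k ≤ 1 / 3 := by nlinarith
  have h₉ : confidenceBonus n δ k ^ 2 ≤ 1 / 9 := by nlinarith
  nlinarith [Real.log_two_gt_d9]

/-- The value 1/2 cancels the factor 2 of the two-sided tail bound. The start at 3 matters: sums
from 2 eventually exceed 1/2. -/
theorem sum_Icc_one_div_sq_le (K : ℕ) :
    ∑ k ∈ Finset.Icc 3 K, 1 / (k : ℝ) ^ 2 ≤ 1 / 2 := by
  rcases Nat.lt_or_ge K 3 with hK | hK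
  · rw [Finset.Icc_eq_empty (by omega), Finset.sum_empty]
    norm_num
  have : ∑ k ∈ Finset.Icc 3 K, 1 / (k : ℝ) ^ 2 ≤ 1 / 2 - 1 / (K : ℝ) := by
    induction K, hK using Nat.le_induction with
    | base => norm_num
    | succ K hK ih =>
      rw [Finset.sum_Icc_succ_top (by omega)]
      have hK' : (0 : ℝ) < K := by positivity
      have : 1 / ((K + 1 : ℕ) : ℝ) ^ 2 ≤ 1 / K - 1 / ((K + 1 : ℕ) : ℝ) := by
        push_cast
        rw [div_sub_div _ _ (by positivity) (by positivity), div_le_div_iff₀ (by positivity)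
          (by positivity)]
        nlinarith
      linarith
  have hK' : (0 : ℝ) ≤ 1 / K := by positivity
  linarith

/-- With high probability all estimates are within the confidence bonus, uniformly over the epochs
after the second one. -/
theorem measure_bonus_le_le {Ω : Type*} [MeasurableSpace Ω] {Pr : Measure Ω}
    [IsProbabilityMeasure Pr] (hn : 2 ≤ n) (G : StochasticGame n) (h₀ : G.expectedReward ∅ = 0)
    (P : Fin n → Equiv.Perm (Fin n)) {δ : ℝ} (hδ : 0 < δ) (hδ₁ : δ ≤ 1)
    {r : ℕ → Fin n → Fin n → Ω → unitInterval}
    (hr : ∀ s p i, HasLaw (r s p i)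
      (G.reward (prefixCoalition (P p) i) : Measure unitInterval) Pr)
    (hind : iIndepFun (fun k : ℕ × Fin n × Fin n => r k.1 k.2.1 k.2.2) Pr) (K : ℕ) :
    Pr {z | ∃ k ∈ Finset.Icc 3 K, ∃ p i, confidenceBonus n δ k ≤
      |estimates (G.expectedReward Finset.univ) P (fun s p i => r s p i z) k p i
        - marginalVector G.expectedReward (P p) i|} ≤ ENNReal.ofReal δ := by
  set E : ℕ → Fin n → Fin n → Set Ω := fun k p i => {z | confidenceBonus n δ k ≤
      |estimates (G.expectedReward Finset.univ) P (fun s p i => r s p i z) k p i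
        - marginalVector G.expectedReward (P p) i|} with hE
  have hset : {z | ∃ k ∈ Finset.Icc 3 K, ∃ p i, confidenceBonus n δ k ≤
      |estimates (G.expectedReward Finset.univ) P (fun s p i => r s p i z) k p i
        - marginalVector G.expectedReward (P p) i|} =
      ⋃ l ∈ Finset.Icc 3 K ×ˢ (Finset.univ : Finset (Fin n × Fin n)), E l.1 l.2.1 l.2.2 := by
    ext z
    simp [hE]
  have hsingle : ∀ k ∈ Finset.Icc 3 K, ∀ p i,
      Pr.real (E k p i) ≤ 2 * (δ / n) ^ 2 * (1 / (k : ℝ) ^ 2) := by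
    intro k hk p i
    have hk₁ : 1 ≤ k := by
      have := (Finset.mem_Icc.1 hk).1
      omega
    have hk' : (0 : ℝ) < k := by exact_mod_cast hk₁
    have hn' : (0 : ℝ) < n := by exact_mod_cast (by omega : 0 < n)
    have hindp : iIndepFun (fun l : ℕ × Fin n => r l.1 p l.2) Pr :=
      hind.precomp (g := fun l : ℕ × Fin n => (l.1, p, l.2)) fun x y h => by
        simp only [Prod.mk.injEq, true_and] at h
        exact Prod.ext h.1 h.2
    have h := measureReal_le_abs_empiricalMarginal_sub G h₀ (P p) (a := fun s j => r s p j)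
      (fun s j => hr s p j) hindp i hk₁ (confidenceBonus_pos hn hδ hδ₁ hk₁).le
    refine h.trans (le_of_eq ?_)
    have hx : (0 : ℝ) < n * k * δ⁻¹ := by positivity
    -- The bonus is chosen so that exp(-k b²) = (δ/(nk))². The factor 1/n² pays for the n² pairs
    -- `(p, i)`, and 1/k² is summable.
    rw [confidenceBonus_sq hn hδ hδ₁ hk₁, mul_div_cancel₀ _ hk'.ne', Real.exp_neg, two_mul
      (Real.log _), Real.exp_add, Real.exp_log hx]
    field_simp
  rw [hset, ← ofReal_measureReal (measure_ne_top _ _)]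
  refine ENNReal.ofReal_le_ofReal ?_
  refine (measureReal_biUnion_finset_le _ _).trans ?_
  have hn' : (0 : ℝ) < n := by exact_mod_cast (by omega : 0 < n)
  calc _ ≤ ∑ l ∈ Finset.Icc 3 K ×ˢ (Finset.univ : Finset (Fin n × Fin n)),
        2 * (δ / n) ^ 2 * (1 / (l.1 : ℝ) ^ 2) :=
        Finset.sum_le_sum fun l hl => hsingle l.1 (Finset.mem_product.1 hl).1 _ _
    _ = 2 * δ ^ 2 * ∑ k ∈ Finset.Icc 3 K, 1 / (k : ℝ) ^ 2 := by
        rw [Finset.sum_product, Finset.mul_sum]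
        refine Finset.sum_congr rfl fun k _ => ?_
        simp only [Finset.sum_const, Finset.card_univ, Fintype.card_prod, Fintype.card_fin,
          nsmul_eq_mul]
        push_cast
        field_simp
    _ ≤ 2 * δ ^ 2 * (1 / 2) := by
        have := sum_Icc_one_div_sq_le K
        gcongr
    _ ≤ δ := by nlinarith

/-- An epoch count that makes the confidence bonus small. -/
theorem exists_epoch (hn : 2 ≤ n) {ς δ : ℝ} (hς : 0 < ς) (hς₁ : ς ≤ 1) (hδ : 0 < δ)
    (hδ₁ : δ ≤ 1) : ∃ K : ℕ, 3 ≤ K ∧ confidenceBonus n δ K < ς / (6 * (n : ℝ) ^ 3) ∧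
      (K : ℝ) ≤ 4096 * ((n : ℝ) ^ 6 / ς ^ 2 * Real.log (n * δ⁻¹ * ς⁻¹)) := by
  set X : ℝ := n * δ⁻¹ * ς⁻¹ with hX
  have hn' : (2 : ℝ) ≤ n := by exact_mod_cast hn
  have hδi : 1 ≤ δ⁻¹ := (one_le_inv₀ hδ).2 hδ₁
  have hςi : 1 ≤ ς⁻¹ := (one_le_inv₀ hς).2 hς₁
  have hX₂ : 2 ≤ X := by
    calc (2 : ℝ) = 2 * 1 * 1 := by norm_num
      _ ≤ X := by rw [hX]; gcongr
  have hnςX : n * ς⁻¹ ≤ X := by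
    calc n * ς⁻¹ = n * 1 * ς⁻¹ := by ring
      _ ≤ X := by rw [hX]; gcongr
  have hnδX : n * δ⁻¹ ≤ X := by
    calc n * δ⁻¹ = n * δ⁻¹ * 1 := by ring
      _ ≤ X := by rw [hX]; gcongr
  have hlog : 1 / 2 ≤ Real.log X :=
    (by linarith [Real.log_two_gt_d9] : 1 / 2 ≤ Real.log 2).trans
      (Real.log_le_log (by norm_num) hX₂)
  set B : ℝ := (n : ℝ) ^ 6 / ς ^ 2 * Real.log X with hB
  have hn6 : (64 : ℝ) ≤ (n : ℝ) ^ 6 := by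
    calc (64 : ℝ) = 2 ^ 6 := by norm_num
      _ ≤ _ := by gcongr
  have hnς : (64 : ℝ) ≤ (n : ℝ) ^ 6 / ς ^ 2 := by
    rw [le_div_iff₀ (by positivity)]
    nlinarith
  have hB₁ : 1 ≤ B := by rw [hB]; nlinarith
  have hK₁ := Nat.le_ceil (2048 * B)
  have hK₂ := (Nat.ceil_lt_add_one (by positivity : 0 ≤ 2048 * B)).le
  set K := ⌈2048 * B⌉₊ with hK
  have hK3 : 3 ≤ K := by
    have : (3 : ℝ) ≤ K := by linarith
    exact_mod_cast this
  have hK4 : (K : ℝ) ≤ 4096 * B := by linarith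
  have hKpos : (0 : ℝ) < K := by linarith
  refine ⟨K, hK3, ?_, hK4⟩
  have hBX : B ≤ X ^ 7 := by
    have h₁ : (n : ℝ) ^ 6 / ς ^ 2 ≤ (n * ς⁻¹) ^ 6 := by
      rw [mul_pow, div_eq_mul_inv, ← inv_pow]
      exact mul_le_mul_of_nonneg_left (pow_le_pow_right₀ hςi (by norm_num)) (by positivity)
    have h₂ : Real.log X ≤ X := (Real.log_le_sub_one_of_pos (by linarith)).trans (by linarith)
    calc B ≤ (n * ς⁻¹) ^ 6 * X := by
          rw [hB]
          gcongr
      _ ≤ X ^ 6 * X := by gcongr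
      _ = X ^ 7 := by ring
  -- As X ≥ 2, the constant 4096 = 2¹² is at most X¹². So b²K ≤ 40 log X, below the available
  -- (2048/36) log X.
  have harg : n * K * δ⁻¹ ≤ X ^ 20 := by
    calc n * K * δ⁻¹ = (n * δ⁻¹) * K := by ring
      _ ≤ X * (2 ^ 12 * X ^ 7) := by
        gcongr
        linarith
      _ ≤ X * (X ^ 12 * X ^ 7) := by gcongr
      _ = X ^ 20 := by ring
  have hlogK : Real.log (n * K * δ⁻¹) ≤ 20 * Real.log X := by
    have h := Real.log_le_log (by positivity) harg
    rw [Real.log_pow] at h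
    exact_mod_cast h
  refine lt_of_pow_lt_pow_left₀ 2 (by positivity) ?_
  rw [confidenceBonus_sq hn hδ hδ₁ (by omega), div_lt_iff₀ hKpos]
  have hc : (ς / (6 * (n : ℝ) ^ 3)) ^ 2 * (2048 * B) = 2048 / 36 * Real.log X := by
    rw [hB]
    field_simp
    ring
  have hmul := mul_le_mul_of_nonneg_left hK₁ (by positivity : 0 ≤ (ς / (6 * (n : ℝ) ^ 3)) ^ 2)
  rw [hc] at hmul
  linarith

/-! ### Correctness and sample bound -/

/-- The algorithm succeeds as soon as the estimates are uniformly precise. -/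
theorem exists_returns_of_forall_abs_sub_lt (hn : 2 ≤ n) (G : StochasticGame n) {ς δ : ℝ}
    (hς : 0 < ς) (h₀ : G.expectedReward ∅ = 0) (hG : G.IsStrictlyConvex ς)
    (ω : Equiv.Perm (Fin n)) (hδ : 0 < δ) (hδ₁ : δ ≤ 1) {K : ℕ} (hK : 3 ≤ K)
    (hbK : confidenceBonus n δ K < ς / (6 * (n : ℝ) ^ 3))
    {a : ℕ → Fin n → Fin n → unitInterval}
    (ha : ∀ k ∈ Finset.Icc 3 K, ∀ p i,
      |estimates (G.expectedReward Finset.univ) (adjacentFamily ω) a k p i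
        - marginalVector G.expectedReward (adjacentFamily ω p) i| < confidenceBonus n δ k) :
    ∃ (T : ℕ) (x : Fin n → ℝ),
      Returns (G.expectedReward Finset.univ) δ (adjacentFamily ω) a T x ∧
        T ≤ K * (n * n) ∧ x ∈ G.expectedCore := by
  classical
  have hn₀ : 0 < n := by omega
  set Q := estimates (G.expectedReward Finset.univ) (adjacentFamily ω) a with hQ
  have hpassK : 1 ≤ K ∧ StoppingCondition (Q K) (confidenceBonus n δ K) :=
    ⟨by omega, stoppingCondition_of_abs_sub_le hn hς hG ω
      (confidenceBonus_pos hn hδ hδ₁ (by omega)) hbK fun p i =>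
        (ha K (Finset.mem_Icc.2 ⟨hK, le_rfl⟩) p i).le⟩
  have hpass : ∃ k, 1 ≤ k ∧ StoppingCondition (Q k) (confidenceBonus n δ k) := ⟨K, hpassK⟩
  obtain ⟨hk₁, hk⟩ := Nat.find_spec hpass
  have hkK : Nat.find hpass ≤ K := Nat.find_min' hpass hpassK
  set k := Nat.find hpass with hkdef
  have hQ₁ : ∀ p i, |Q k p i| ≤ 1 := fun p i =>
    abs_empiricalMarginal_le_one (G.expectedReward_mem_Icc _) _ _ _ _
  -- The first passing epoch must fall in the range where precision is assumed.
  have hk₃ : 3 ≤ k := hk.three_le hn hδ hδ₁ hk₁ hQ₁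
  have hMQ : ∀ p, ∑ i, Q k p i = G.expectedReward Finset.univ := fun p =>
    sum_empiricalMarginal hn₀ _ _ _ hk₁
  have hn' : (n : ℝ) ≠ 0 := by positivity
  refine ⟨k * (n * n), _, ⟨k, hk₁, hk, fun m hm hmk h => Nat.find_min hpass hmk ⟨hm, h⟩, rfl, rfl⟩,
    Nat.mul_le_mul_right _ hkK, ?_, fun S => ?_⟩
  · rw [← Finset.mul_sum, Finset.sum_comm]
    rw [Finset.sum_congr rfl fun p _ => hMQ p]
    simp [hn']
  · have hS : ∀ y : Fin n → ℝ, (fun i => if i ∈ S then (1 : ℝ) else 0) ⬝ᵥ y = ∑ i ∈ S, y i := by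
      intro y
      simp [dotProduct]
    rw [← hS]
    refine hk.le_dotProduct_average hn₀ (confidenceBonus_pos hn hδ hδ₁ hk₁) hMQ
      (φ := fun p => marginalVector G.expectedReward (adjacentFamily ω p)) (fun p => ?_)
      (fun p i => (ha k (Finset.mem_Icc.2 ⟨hk₃, hkK⟩) p i).le) fun q => ?_
    · rw [sum_marginalVector, h₀, sub_zero]
    · rw [hS]
      exact le_sum_marginalVector hG.1 h₀ _ S

end CommonPointsPicking

theorem theorem4 :
    ∃ C : ℝ, 0 < C ∧
      ∀ (n : ℕ), 2 ≤ n →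
      ∀ (G : StochasticGame n) (ς : ℝ), 0 < ς →
        G.expectedReward ∅ = 0 → G.IsStrictlyConvex ς →
      ∀ (ω : Equiv.Perm (Fin n)) (δ : ℝ), 0 < δ → δ ≤ 1 →
      ∀ {Ω : Type*} [MeasurableSpace Ω] (Pr : Measure Ω) [IsProbabilityMeasure Pr]
        (r : ℕ → Fin n → Fin n → Ω → unitInterval),
        (∀ s p i, HasLaw (r s p i)
          (G.reward (CommonPointsPicking.prefixCoalition
            (CommonPointsPicking.adjacentFamily ω p) i) : Measure unitInterval) Pr) →
        iIndepFun (fun k : ℕ × Fin n × Fin n => r k.1 k.2.1 k.2.2) Pr →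
        Pr {z | ¬ ∃ (T : ℕ) (x : Fin n → ℝ),
            CommonPointsPicking.Returns (G.expectedReward Finset.univ) δ
              (CommonPointsPicking.adjacentFamily ω) (fun s p i => r s p i z) T x ∧
            (T : ℝ) ≤ C * ((n : ℝ) ^ 15 * Real.log (n * δ⁻¹ * ς⁻¹) / ς ^ 4) ∧
            x ∈ G.expectedCore}
          ≤ ENNReal.ofReal δ := by
  refine ⟨4096, by norm_num, ?_⟩
  intro n hn G ς hς h₀ hG ω δ hδ hδ₁ Ω _ Pr _ r hr hind
  have hς₁ : ς ≤ 1 := CommonPointsPicking.strictlySupermodular_constant_le_one hn hG h₀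
    G.expectedReward_mem_Icc
  obtain ⟨K, hK₃, hbK, hK⟩ := CommonPointsPicking.exists_epoch hn hς hς₁ hδ hδ₁
  -- Failure is contained in the event of an imprecise estimate; monotonicity requires no
  -- measurability of the failure event.
  refine (measure_mono fun z hz => ?_).trans
    (CommonPointsPicking.measure_bonus_le_le hn G h₀ _ hδ hδ₁ hr hind K)
  by_contra hgood
  simp only [Set.mem_ofPred_eq, not_exists, not_and, not_le] at hgood
  obtain ⟨T, x, hret, hT, hx⟩ := CommonPointsPicking.exists_returns_of_forall_abs_sub_lt hn G hς
    h₀ hG ω hδ hδ₁ hK₃ hbK hgood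
  refine hz ⟨T, x, hret, ?_, hx⟩
  have hn' : (1 : ℝ) ≤ n := by exact_mod_cast (by omega : 1 ≤ n)
  have hX : (1 : ℝ) ≤ n * δ⁻¹ * ς⁻¹ := by
    calc (1 : ℝ) = 1 * 1 * 1 := by norm_num
      _ ≤ _ := by
        gcongr
        · exact (one_le_inv₀ hδ).2 hδ₁
        · exact (one_le_inv₀ hς).2 hς₁
  have hlog := Real.log_nonneg hX
  calc (T : ℝ) ≤ K * (n * n) := by exact_mod_cast hT
    _ ≤ 4096 * ((n : ℝ) ^ 6 / ς ^ 2 * Real.log (n * δ⁻¹ * ς⁻¹)) * (n * n) := by gcongr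
    -- The argument gives the stronger order n⁸/ς²; n ≥ 1 and ς ≤ 1 weaken it to the stated one.
    _ = 4096 * ((n : ℝ) ^ 8 * Real.log (n * δ⁻¹ * ς⁻¹) / ς ^ 2) := by ring
    _ ≤ 4096 * ((n : ℝ) ^ 15 * Real.log (n * δ⁻¹ * ς⁻¹) / ς ^ 4) := by
      gcongr 4096 * (?_ * _ / ?_)
      · exact pow_le_pow_right₀ hn' (by norm_num)
      · exact pow_le_pow_of_le_one hς.le hς₁ (by norm_num)
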